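/- A dynamical system $(X,f)$ is a continuous map $f:X\to X$ of a compact metric space $X$; $(Y,g)$ is a \emph{factor} of $(X,f)$ if there is a continuous surjection $\varphi:X\to Y$ with $g\varphi=\varphi f$. For finite sets $A,Q,B$ let $X$ be the space of all bi-infinite sequences $u=(u_i)_{i\in\mathbb Z}$ with $u_i\in A$ for $i>0$, $u_0\in Q$ and $u_i\in B$ for $i<0$, with the product topology (equivalently, the metric $\varrho(u,v)=2^{-n}$, $n=\inf\{i\ge 0: u_i\ne v_i\text{ or }u_{-i}\ne v_{-i}\}$). For functions $f_A:Q\times A\to Q$ and $f_B:Q\to B$, the \emph{finite automaton} given by $(A,Q,B,f_A,f_B)$ is the dynamical system $f:X\to X$ with $f(u)_{-1}=f_B(u_0)$, $f(u)_0=f_A(u_0,u_1)$ and $f(u)_i=u_{i+1}$ for $i\ne -1,0$. Let $I=[-1,1]$. A \emph{symmetric unimodal system} is a continuously differentiable even function $g:I\to\mathbb R$ such that $g(-1)=g(1)=-1$, $g(0)>-1$, $g'(x)=0$ if and only if $x=0$, and $g(I)\subseteq I$. If moreover $g(0)>0$, there is a unique $p\in(0,1)$ with $g(-p)=g(p)=p$,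 and the \emph{renormalization} of $g$ is $\mathcal R g(x)=-g(g(px))/p$ for $x\in I$; if $\mathcal R g(0)\le 1$, then $\mathcal R g$ maps $I$ into itself. \textbf{Theorem.} Let $g$ be a symmetric unimodal system with $g(0)>0$ that has only finitely many fixed points in $I$, and suppose that $\mathcal R g(0)\le 1$. If $(I,\mathcal R g)$ is a factor of a finite automaton, then $(I,g)$ is also a factor of a finite automaton. -/

import Mathlib

open Set Function

/-- `g` on `Y` is a factor of `f` on `X`: there is a continuous surjection `φ : X → Y` with
`g ∘ φ = φ ∘ f`. -/
def IsFactor {X Y : Type*} [TopologicalSpace X] [TopologicalSpace Y] (f : X → X) (g : Y → Y) :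
    Prop :=
  ∃ φ : X → Y, Continuous φ ∧ Surjective φ ∧ ∀ x, g (φ x) = φ (f x)

/-- The alphabet allowed at position `i` of a configuration: input letters at `i > 0`, inner states
at `i = 0`, output letters at `i < 0`. -/
def Cell (A Q B : Type) : ℤ → Type
  | Int.ofNat 0 => Q
  | Int.ofNat (_ + 1) => A
  | Int.negSucc _ => B

/-- Every cell carries the discrete topology. -/
instance instTopologicalSpaceCell (A Q B : Type) (i : ℤ) : TopologicalSpace (Cell A Q B i) := ⊥

instance instDiscreteTopologyCell (A Q B : Type) (i : ℤ) : DiscreteTopology (Cell A Q B i) := ⟨rfl⟩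

/-- The discontinuum over `A, Q, B`: sequences `u` indexed by the integers with `u i ∈ A` for
`i > 0`, `u 0 ∈ Q`, `u i ∈ B` for `i < 0`. It carries the product topology, which is the topology
of the metric `ρ(u, v) = 2 ^ (-n)`, `n = inf {i ≥ 0 | u i ≠ v i or u (-i) ≠ v (-i)}`. -/
abbrev Discontinuum (A Q B : Type) : Type := (i : ℤ) → Cell A Q B i

/-- A finite automaton with input alphabet `A`, set of inner states `Q` and output alphabet `B`
(finiteness is imposed where automata are quantified over). -/
structure FiniteAutomaton (A Q B : Type) where
  /-- the input function `f_A` -/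
  input : Q → A → Q
  /-- the output function `f_B` -/
  output : Q → B

/-- The automaton as a dynamical system on the discontinuum:
`f(… u₋₂, u₋₁, u₀, u₁, u₂ …) = (… u₋₁, f_B(u₀), f_A(u₀, u₁), u₂, u₃ …)`, where the entry at
position `0` of the result is `f_A(u₀, u₁)`. -/
def FiniteAutomaton.step {A Q B : Type} (M : FiniteAutomaton A Q B) (u : Discontinuum A Q B) :
    Discontinuum A Q B
  | Int.ofNat 0 => M.input (u (Int.ofNat 0)) (u (Int.ofNat 1))
  | Int.ofNat (n + 1) => u (Int.ofNat (n + 2))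
  | Int.negSucc 0 => M.output (u (Int.ofNat 0))
  | Int.negSucc (n + 1) => u (Int.negSucc n)

/-- The system `g` on `Y` is a factor of some finite automaton. -/
def IsFactorOfFiniteAutomaton {Y : Type*} [TopologicalSpace Y] (g : Y → Y) : Prop :=
  ∃ (A Q B : Type) (_ : Finite A) (_ : Finite Q) (_ : Finite B) (M : FiniteAutomaton A Q B),
    IsFactor M.step g

/-- `g` is a symmetric unimodal function on `[-1, 1]`; only the values of `g` on `[-1, 1]` matter.
-/
structure IsSymmetricUnimodal (g : ℝ → ℝ) : Prop where
  contDiffOn : ContDiffOn ℝ 1 g (Icc (-1) 1)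
  symmetric : ∀ x ∈ Icc (-1 : ℝ) 1, g (-x) = g x
  map_neg_one : g (-1) = -1
  map_one : g 1 = -1
  neg_one_lt : -1 < g 0
  derivWithin_eq_zero_iff : ∀ x ∈ Icc (-1 : ℝ) 1, derivWithin g (Icc (-1) 1) x = 0 ↔ x = 0

/-- A symmetric unimodal system: a symmetric unimodal function mapping `[-1, 1]` into itself. -/
structure IsSymmetricUnimodalSystem (g : ℝ → ℝ) : Prop extends IsSymmetricUnimodal g where
  mapsTo : MapsTo g (Icc (-1) 1) (Icc (-1) 1)

/-- `p` is a point of `(0, 1)` with `g(-p) = g(p) = p`. -/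
def IsRenormalizationPoint (g : ℝ → ℝ) (p : ℝ) : Prop :=
  0 < p ∧ p < 1 ∧ g (-p) = p ∧ g p = p

/-- The point `p ∈ (0, 1)` with `g(-p) = g(p) = p`; it exists and is unique if `g` is symmetric
unimodal with `g(0) > 0`, see `IsSymmetricUnimodal.existsUnique_isRenormalizationPoint`. -/
noncomputable def renormalizationPoint (g : ℝ → ℝ) : ℝ :=
  Classical.epsilon (IsRenormalizationPoint g)

/-- The renormalization `R g (x) = - g (g (p x)) / p`. -/
noncomputable def renormalization (g : ℝ → ℝ) (x : ℝ) : ℝ :=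
  -g (g (renormalizationPoint g * x)) / renormalizationPoint g

theorem IsSymmetricUnimodal.strictAntiOn {g : ℝ → ℝ} (hg : IsSymmetricUnimodal g) :
    StrictAntiOn g (Icc 0 1) := by
  have hc : ContinuousOn g (Icc 0 1) :=
    hg.contDiffOn.continuousOn.mono (Icc_subset_Icc_left (by norm_num))
  have key : ∀ a b : ℝ, 0 ≤ a → b ≤ 1 → a < b → g a ≠ g b := by
    intro a b ha hb hab he
    obtain ⟨c, hcab, hd⟩ := exists_deriv_eq_zero hab (hc.mono (Icc_subset_Icc ha hb)) he
    have hc1 : -1 < c := by linarith [hcab.1]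
    have hc2 : c < 1 := by linarith [hcab.2]
    have h1 : derivWithin g (Icc (-1) 1) c = 0 := by
      rw [derivWithin_of_mem_nhds (Icc_mem_nhds hc1 hc2), hd]
    have := (hg.derivWithin_eq_zero_iff c ⟨hc1.le, hc2.le⟩).1 h1
    linarith [hcab.1]
  refine hc.strictAntiOn_of_injOn_Icc zero_le_one ?_ ?_
  · rw [hg.map_one]; exact hg.neg_one_lt.le
  · intro a ha b hb he
    rcases lt_trichotomy a b with h | h | h
    · exact absurd he (key a b ha.1 hb.2 h)
    · exact h
    · exact absurd he.symm (key b a hb.1 ha.2 h)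

theorem IsSymmetricUnimodal.existsUnique_isRenormalizationPoint {g : ℝ → ℝ}
    (hg : IsSymmetricUnimodal g) (h0 : 0 < g 0) : ∃! p, IsRenormalizationPoint g p := by
  have hc : ContinuousOn (fun x => g x - x) (Icc 0 1) :=
    (hg.contDiffOn.continuousOn.mono (Icc_subset_Icc_left (by norm_num))).sub continuousOn_id
  have hmem : (0 : ℝ) ∈ Icc (g 1 - 1) (g 0 - 0) := by
    rw [hg.map_one]; constructor <;> linarith
  obtain ⟨p, hp, hpe⟩ := intermediate_value_Icc' zero_le_one hc hmem
  have hpe' : g p = p := by simpa [sub_eq_zero] using hpe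
  have hp0 : p ≠ 0 := by rintro rfl; linarith
  have hp1 : p ≠ 1 := by rintro rfl; linarith [hg.map_one]
  refine ⟨p, ⟨lt_of_le_of_ne hp.1 hp0.symm, lt_of_le_of_ne hp.2 hp1, ?_, hpe'⟩, ?_⟩
  · rw [hg.symmetric p ⟨by linarith [hp.1], hp.2⟩, hpe']
  · rintro q ⟨hq0, hq1, -, hqe⟩
    have hq : q ∈ Icc (0 : ℝ) 1 := ⟨hq0.le, hq1.le⟩
    rcases lt_trichotomy q p with h | h | h
    · linarith [hg.strictAntiOn hq hp h]
    · exact h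
    · linarith [hg.strictAntiOn hp hq h]

theorem IsSymmetricUnimodal.isRenormalizationPoint {g : ℝ → ℝ}
    (hg : IsSymmetricUnimodal g) (h0 : 0 < g 0) :
    IsRenormalizationPoint g (renormalizationPoint g) :=
  Classical.epsilon_spec (hg.existsUnique_isRenormalizationPoint h0).exists

/-- If `g(0) > 0` and `R g (0) ≤ 1`, then `R g` maps `[-1, 1]` into itself, so that it is a
dynamical system on `[-1, 1]`. -/
theorem IsSymmetricUnimodalSystem.mapsTo_renormalization {g : ℝ → ℝ}
    (hg : IsSymmetricUnimodalSystem g) (h0 : 0 < g 0) (hR : renormalization g 0 ≤ 1) :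
    MapsTo (renormalization g) (Icc (-1) 1) (Icc (-1) 1) := by
  obtain ⟨hp0, hp1, -, hpe⟩ := hg.isRenormalizationPoint h0
  have hanti := hg.strictAntiOn.antitoneOn
  unfold renormalization at hR ⊢
  set p := renormalizationPoint g
  intro x hx
  have habs : g (p * x) = g |p * x| := by
    rcases abs_choice (p * x) with h | h
    · rw [h]
    · rw [h, hg.symmetric]
      constructor <;> nlinarith [hx.1, hx.2]
  have hle : |p * x| ≤ p := by
    rw [abs_mul, abs_of_pos hp0]
    nlinarith [abs_le.2 ⟨hx.1, hx.2⟩]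
  have hm : |p * x| ∈ Icc (0 : ℝ) 1 := ⟨abs_nonneg _, hle.trans hp1.le⟩
  have hpm : p ∈ Icc (0 : ℝ) 1 := ⟨hp0.le, hp1.le⟩
  have h1 : p ≤ g (p * x) := by
    rw [habs]; simpa [hpe] using hanti hm hpm hle
  have h2 : g (p * x) ≤ g 0 := by
    rw [habs]; exact hanti ⟨le_rfl, zero_le_one⟩ hm (abs_nonneg _)
  have h3 : g 0 ≤ 1 := (hg.mapsTo ⟨by norm_num, by norm_num⟩).2
  have h4 : g (g (p * x)) ≤ p := by
    simpa [hpe] using hanti hpm ⟨hp0.le.trans h1, h2.trans h3⟩ h1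
  have h5 : g (g 0) ≤ g (g (p * x)) :=
    hanti ⟨hp0.le.trans h1, h2.trans h3⟩ ⟨h0.le, h3⟩ h2
  rw [mul_zero, div_le_one hp0] at hR
  change -1 ≤ _ ∧ _ ≤ 1
  rw [le_div_iff₀ hp0, div_le_one hp0]
  constructor <;> linarith

/-! Multiplication by `-p` conjugates `renormalization g` to `g ∘ g` on `J = [-p, p]`, so `g ∘ g` is
presented on `J` (`presents_iterate_two`), and an automaton run at half speed presents `g` on `J ∪
g(J)` (`Presents.of_iterate_two`).

Let `e` be the greatest fixed point of `g` in `[-1, 0]`. Then `e < -p`, and `g` moves the points of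
`(e, 0]` up. As `g(-p) = p`, every orbit starting in `(e, -p)` enters `J`. So `[e, p]` consists of
`e` and of preimages of points of `J` under the increasing branch, whose inverse contracts to `e`. A
waiting phase in front of the automaton adds them (`covers_source`): the waiting time is the
distance to an entry letter on the input tape, and no entry letter means `e`.

On `[-1, e]` the map increases and has finitely many fixed points. Between adjacent ones every orbit
meets a fundamental domain, which is coded by bit sequences. An automaton copying input to output
presents the forward orbits (`sinkMap`: the elapsed time is the distance to a mark on the output
tape, and no mark means the limit); a waiting phase adds the backward ones (`covers_fullOrbit`).

Finite unions and, `g` being even, mirror images preserve presentability, so `[-1, p]` yields `[-1,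
1]`. Stray points are harmless, hence `Covers`: the final map is retracted onto `[-1, 1]`. -/

/-! ### Configurations -/

/-- Prepend a letter to a one-sided sequence. -/
def push {α : Type} (a : α) (l : ℕ → α) : ℕ → α
  | 0 => a
  | n + 1 => l n

@[simp] theorem push_zero {α : Type} (a : α) (l : ℕ → α) : push a l 0 = a := rfl

@[simp] theorem push_succ {α : Type} (a : α) (l : ℕ → α) (n : ℕ) : push a l (n + 1) = l n := rfl

/-- A point of the discontinuum, split into output tape, inner state and input tape, both tapes
being read starting next to the state. -/
@[ext] structure Config (A Q B : Type) where
  /-- the output tape -/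
  left : ℕ → B
  /-- the inner state -/
  state : Q
  /-- the input tape -/
  right : ℕ → A

/-- The two configurations agree up to distance `n` from the state. -/
structure Config.Agree {A Q B : Type} (n : ℕ) (u v : Config A Q B) : Prop where
  left : ∀ i < n, u.left i = v.left i
  state : u.state = v.state
  right : ∀ i < n, u.right i = v.right i

/-- Continuity with respect to the product topology of discrete spaces. -/
def Config.IsContinuous {A Q B : Type} (φ : Config A Q B → ℝ) : Prop :=
  ∀ u, ∀ ε > 0, ∃ n, ∀ v, u.Agree n v → |φ v - φ u| < ε

/-- The action of an automaton on configurations. -/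
def FiniteAutomaton.next {A Q B : Type} (M : FiniteAutomaton A Q B) (u : Config A Q B) :
    Config A Q B where
  left := push (M.output u.state) u.left
  state := M.input u.state (u.right 0)
  right i := u.right (i + 1)

/-- There is a continuous map from the configurations of some finite automaton onto `S` which
semiconjugates the automaton to `G`. -/
def Presents (G : ℝ → ℝ) (S : Set ℝ) : Prop :=
  ∃ (A Q B : Type) (_ : Finite A) (_ : Finite Q) (_ : Finite B) (_ : Nonempty A) (_ : Nonempty Q)
    (_ : Nonempty B) (M : FiniteAutomaton A Q B) (φ : Config A Q B → ℝ),
    Config.IsContinuous φ ∧ (∀ u, G (φ u) = φ (M.next u)) ∧ range φ = S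

/-- A set containing `S` is presented by some finite automaton. -/
def Covers (G : ℝ → ℝ) (S : Set ℝ) : Prop :=
  ∃ S', S ⊆ S' ∧ Presents G S'

theorem Covers.mono {G : ℝ → ℝ} {S T : Set ℝ} (h : Covers G T) (hST : S ⊆ T) : Covers G S :=
  let ⟨S', h1, h2⟩ := h
  ⟨S', hST.trans h1, h2⟩

namespace Config

variable {A Q B : Type}

theorem IsContinuous.comp {φ : Config A Q B → ℝ} (hφ : IsContinuous φ) {F : ℝ → ℝ}
    (hF : Continuous F) : IsContinuous fun u => F (φ u) := by
  intro u ε hε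
  obtain ⟨δ, hδ, h⟩ := Metric.continuous_iff.1 hF (φ u) ε hε
  obtain ⟨n, hn⟩ := hφ u δ hδ
  exact ⟨n, fun v hv => h _ (hn v hv)⟩

/-- The point of the discontinuum given by a configuration. -/
def toDiscontinuum (u : Config A Q B) : Discontinuum A Q B
  | Int.ofNat 0 => u.state
  | Int.ofNat (n + 1) => u.right n
  | Int.negSucc n => u.left n

/-- The configuration given by a point of the discontinuum. -/
def ofDiscontinuum (x : Discontinuum A Q B) : Config A Q B where
  left n := x (Int.negSucc n)
  state := x (Int.ofNat 0)
  right n := x (Int.ofNat (n + 1))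

theorem toDiscontinuum_ofDiscontinuum (x : Discontinuum A Q B) :
    (ofDiscontinuum x).toDiscontinuum = x := by
  funext i
  rcases i with (_ | n) | n <;> rfl

theorem toDiscontinuum_next (M : FiniteAutomaton A Q B) (u : Config A Q B) :
    (M.next u).toDiscontinuum = M.step u.toDiscontinuum := by
  funext i
  rcases i with (_ | n) | (_ | n) <;> rfl

theorem ofDiscontinuum_step (M : FiniteAutomaton A Q B) (x : Discontinuum A Q B) :
    ofDiscontinuum (M.step x) = M.next (ofDiscontinuum x) := by
  ext i
  · rcases i with _ | n <;> rfl
  · rfl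
  · rfl

theorem Agree.toDiscontinuum_eq {n : ℕ} {u v : Config A Q B} (h : u.Agree n v) (i : ℤ)
    (hi : i.natAbs ≤ n) : u.toDiscontinuum i = v.toDiscontinuum i := by
  rcases i with (_ | m) | m
  · exact h.state
  · exact h.right m (Nat.lt_of_succ_le hi)
  · exact h.left m (Nat.lt_of_succ_le hi)

theorem isContinuous_comp_toDiscontinuum {φ : Discontinuum A Q B → ℝ} (hφ : Continuous φ) :
    IsContinuous fun u : Config A Q B => φ u.toDiscontinuum := by
  intro u ε hε
  have hopen : IsOpen (φ ⁻¹' Metric.ball (φ u.toDiscontinuum) ε) :=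
    Metric.isOpen_ball.preimage hφ
  obtain ⟨I, U, hU, hsub⟩ := isOpen_pi_iff.1 hopen u.toDiscontinuum (Metric.mem_ball_self hε)
  refine ⟨I.sup Int.natAbs, fun v hv => ?_⟩
  have : v.toDiscontinuum ∈ φ ⁻¹' Metric.ball (φ u.toDiscontinuum) ε := by
    refine hsub fun i hi => ?_
    rw [← hv.toDiscontinuum_eq i (Finset.le_sup (f := Int.natAbs) hi)]
    exact (hU i hi).2
  exact this

theorem IsContinuous.continuous {φ : Config A Q B → ℝ} (hφ : IsContinuous φ) :
    Continuous fun x : Discontinuum A Q B => φ (ofDiscontinuum x) := by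
  refine continuous_iff_continuousAt.2 fun x => Metric.tendsto_nhds.2 fun ε hε => ?_
  obtain ⟨n, hn⟩ := hφ (ofDiscontinuum x) ε hε
  have key : ∀ i : ℤ, ∀ᶠ y in nhds x, x i = y i := fun i =>
    ((continuous_apply i).continuousAt.eventually_mem
      ((isOpen_discrete {x i}).mem_nhds rfl)).mono fun y hy => Eq.symm hy
  have h1 : ∀ᶠ y in nhds x, ∀ i ∈ Finset.Icc (-(n : ℤ)) n, x i = y i :=
    (Filter.eventually_all_finset _).2 fun i _ => key i
  filter_upwards [h1] with y hy
  refine hn _ ⟨fun i hi => hy _ ?_, hy _ ?_, fun i hi => hy _ ?_⟩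
  · rw [Finset.mem_Icc, Int.negSucc_eq]; omega
  · simp
  · rw [Finset.mem_Icc, Int.ofNat_eq_natCast]; omega

end Config

/-! ### Constructions with presented sets -/

theorem presents_singleton {G : ℝ → ℝ} {e : ℝ} (he : G e = e) : Presents G {e} :=
  ⟨Unit, Unit, Unit, inferInstance, inferInstance, inferInstance, inferInstance, inferInstance,
    inferInstance, ⟨fun _ _ => (), fun _ => ()⟩, fun _ => e,
    fun _ _ hε => ⟨0, fun _ _ => by simpa using hε⟩, fun _ => he,
    haveI : Nonempty (Config Unit Unit Unit) := ⟨⟨fun _ => (), (), fun _ => ()⟩⟩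
    range_const⟩

/-- The tapes carry two tracks and the state tells which automaton is live; the idle track is filled
with junk letters. -/
theorem Presents.union {G : ℝ → ℝ} {S T : Set ℝ} (hS : Presents G S) (hT : Presents G T) :
    Presents G (S ∪ T) := by
  obtain ⟨A, Q, B, _, _, _, ⟨a⟩, ⟨q⟩, ⟨b⟩, M, φ, hφ, hM, rfl⟩ := hS
  obtain ⟨A', Q', B', _, _, _, ⟨a'⟩, ⟨q'⟩, ⟨b'⟩, M', φ', hφ', hM', rfl⟩ := hT
  refine ⟨A × A', Q ⊕ Q', B × B', inferInstance, inferInstance, inferInstance, ⟨a, a'⟩, ⟨.inl q⟩,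
    ⟨b, b'⟩, ⟨fun q c => q.map (M.input · c.1) (M'.input · c.2),
      fun q => q.elim (fun q => (M.output q, b')) (fun q => (b, M'.output q))⟩,
    fun u => u.state.elim (fun q => φ ⟨fun i => (u.left i).1, q, fun i => (u.right i).1⟩)
      (fun q => φ' ⟨fun i => (u.left i).2, q, fun i => (u.right i).2⟩), ?_, ?_, ?_⟩
  · rintro ⟨l, q | q, r⟩ ε hε
    · obtain ⟨n, hn⟩ := hφ ⟨fun i => (l i).1, q, fun i => (r i).1⟩ ε hε
      refine ⟨n, ?_⟩
      rintro ⟨l', q', r'⟩ ⟨h1, h2, h3⟩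
      obtain rfl : Sum.inl q = q' := h2
      exact hn _ ⟨fun i hi => congrArg Prod.fst (h1 i hi), rfl,
        fun i hi => congrArg Prod.fst (h3 i hi)⟩
    · obtain ⟨n, hn⟩ := hφ' ⟨fun i => (l i).2, q, fun i => (r i).2⟩ ε hε
      refine ⟨n, ?_⟩
      rintro ⟨l', q', r'⟩ ⟨h1, h2, h3⟩
      obtain rfl : Sum.inr q = q' := h2
      exact hn _ ⟨fun i hi => congrArg Prod.snd (h1 i hi), rfl,
        fun i hi => congrArg Prod.snd (h3 i hi)⟩
  · rintro ⟨l, q | q, r⟩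
    · refine (hM _).trans (congrArg φ ?_)
      ext i
      · rcases i with _ | i <;> rfl
      · rfl
      · rfl
    · refine (hM' _).trans (congrArg φ' ?_)
      ext i
      · rcases i with _ | i <;> rfl
      · rfl
      · rfl
  · apply Subset.antisymm
    · rintro _ ⟨⟨l, q | q, r⟩, rfl⟩
      · exact Or.inl (mem_range_self _)
      · exact Or.inr (mem_range_self _)
    · rintro _ (⟨u, rfl⟩ | ⟨u, rfl⟩)
      · exact ⟨⟨fun i => (u.left i, b'), .inl u.state, fun i => (u.right i, a')⟩, rfl⟩
      · exact ⟨⟨fun i => (b, u.left i), .inr u.state, fun i => (a, u.right i)⟩, rfl⟩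

theorem Covers.union {G : ℝ → ℝ} {S T : Set ℝ} (hS : Covers G S) (hT : Covers G T) :
    Covers G (S ∪ T) :=
  let ⟨S', h1, h2⟩ := hS
  let ⟨T', h3, h4⟩ := hT
  ⟨S' ∪ T', union_subset_union h1 h3, h2.union h4⟩

/-- The fixed point serves the empty family, since presented sets are nonempty. -/
theorem Covers.biUnion {ι : Type*} {G : ℝ → ℝ} {e : ℝ} (he : G e = e) {I : Set ι} (hI : I.Finite)
    {S : ι → Set ℝ} (hS : ∀ i ∈ I, Covers G (S i)) : Covers G (⋃ i ∈ I, S i) := by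
  induction I, hI using Set.Finite.induction_on with
  | empty => exact ⟨{e}, by simp, presents_singleton he⟩
  | insert _ _ ih =>
    rw [biUnion_insert]
    exact (hS _ (mem_insert _ _)).union (ih fun i hi => hS i (mem_insert_of_mem _ hi))

/-- A presented set can be enlarged by its mirror image under a symmetry of the system. -/
theorem Presents.union_neg {G : ℝ → ℝ} (hG : ∀ x, G (-x) = G x) {S : Set ℝ} (hS : Presents G S) :
    Presents G (S ∪ -S) := by
  obtain ⟨A, Q, B, _, _, _, _, _, _, M, φ, hφ, hM, rfl⟩ := hS
  let π : Config A (Bool × Q) B → Config A Q B := fun u => ⟨u.left, u.state.2, u.right⟩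
  -- The sign bit is cleared by the first step, because `x` and `-x` have the same image.
  refine ⟨A, Bool × Q, B, inferInstance, inferInstance, inferInstance, inferInstance,
    inferInstance, inferInstance, ⟨fun q a => (false, M.input q.2 a), fun q => M.output q.2⟩,
    fun u => bif u.state.1 then -φ (π u) else φ (π u), ?_, ?_, ?_⟩
  · intro u ε hε
    obtain ⟨n, hn⟩ := hφ (π u) ε hε
    refine ⟨n, fun v hv => ?_⟩
    have h := hn (π v) ⟨hv.left, congrArg Prod.snd hv.state, hv.right⟩
    simp only [← hv.state]
    cases u.state.1
    · exact h
    · simpa [abs_sub_comm, neg_add_eq_sub] using h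
  · rintro ⟨l, ⟨_ | _, q⟩, r⟩
    · exact hM _
    · exact (hG _).trans (hM _)
  · apply Subset.antisymm
    · rintro _ ⟨⟨l, ⟨_ | _, q⟩, r⟩, rfl⟩
      · exact Or.inl (mem_range_self _)
      · exact Or.inr ⟨⟨l, q, r⟩, by simp [π]⟩
    · rintro x (⟨u, rfl⟩ | ⟨u, hu⟩)
      · exact ⟨⟨u.left, (false, u.state), u.right⟩, rfl⟩
      · exact ⟨⟨u.left, (true, u.state), u.right⟩, neg_eq_iff_eq_neg.2 hu⟩

theorem Covers.union_neg {G : ℝ → ℝ} (hG : ∀ x, G (-x) = G x) {S : Set ℝ} (hS : Covers G S) :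
    Covers G (S ∪ -S) :=
  let ⟨S', h1, h2⟩ := hS
  ⟨S' ∪ -S', union_subset_union h1 (neg_subset_neg.2 h1), h2.union_neg hG⟩

/-- If the second iterate of a system is presented on `S`, then the system itself is presented on
`S` and its image: run the automaton at half speed on every other letter of the tapes. -/
theorem Presents.of_iterate_two {G : ℝ → ℝ} (hG : Continuous G) {S : Set ℝ}
    (hS : Presents (fun x => G (G x)) S) : Presents G (S ∪ G '' S) := by
  obtain ⟨A, Q, B, _, _, _, _, _, _, M, φ, hφ, hM, rfl⟩ := hS
  -- The simulated tapes occupy the cells of one parity. The idle half step shifts the tapes but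
  -- keeps the state of `M`, so `π₁` after it equals `π₀` before it.
  let π₀ : Config A (Bool × Q) B → Config A Q B :=
    fun u => ⟨fun i => u.left (2 * i), u.state.2, fun i => u.right (2 * i + 1)⟩
  let π₁ : Config A (Bool × Q) B → Config A Q B :=
    fun u => ⟨fun i => u.left (2 * i + 1), u.state.2, fun i => u.right (2 * i)⟩
  have h₀ : ∀ n u v, u.Agree (2 * n) v → (π₀ u).Agree n (π₀ v) := fun n u v h =>
    ⟨fun i hi => h.left _ (by omega), congrArg Prod.snd h.state, fun i hi => h.right _ (by omega)⟩
  have h₁ : ∀ n u v, u.Agree (2 * n) v → (π₁ u).Agree n (π₁ v) := fun n u v h =>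
    ⟨fun i hi => h.left _ (by omega), congrArg Prod.snd h.state, fun i hi => h.right _ (by omega)⟩
  refine ⟨A, Bool × Q, B, inferInstance, inferInstance, inferInstance, inferInstance,
    inferInstance, inferInstance,
    ⟨fun q a => bif q.1 then (false, M.input q.2 a) else (true, q.2), fun q => M.output q.2⟩,
    fun u => bif u.state.1 then G (φ (π₁ u)) else φ (π₀ u), ?_, ?_, ?_⟩
  · intro u ε hε
    cases hu : u.state.1
    · obtain ⟨n, hn⟩ := hφ (π₀ u) ε hε
      refine ⟨2 * n, fun v hv => ?_⟩
      simpa only [← hv.state, hu, cond_false] using hn _ (h₀ n u v hv)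
    · obtain ⟨n, hn⟩ := hφ.comp hG (π₁ u) ε hε
      refine ⟨2 * n, fun v hv => ?_⟩
      simpa only [← hv.state, hu, cond_true] using hn _ (h₁ n u v hv)
  · rintro ⟨l, ⟨_ | _, q⟩, r⟩
    · rfl
    · refine (hM _).trans (congrArg φ ?_)
      ext i
      · rcases i with _ | i <;> rfl
      · rfl
      · rfl
  · apply Subset.antisymm
    · rintro _ ⟨⟨l, ⟨_ | _, q⟩, r⟩, rfl⟩
      · exact Or.inl (mem_range_self _)
      · exact Or.inr (mem_image_of_mem _ (mem_range_self _))
    · rintro _ (⟨u, rfl⟩ | ⟨_, ⟨u, rfl⟩, rfl⟩)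
      · refine ⟨⟨fun i => u.left (i / 2), (false, u.state), fun i => u.right (i / 2)⟩,
          congrArg φ ?_⟩
        ext i
        · exact congrArg u.left (by omega)
        · rfl
        · exact congrArg u.right (by omega)
      · refine ⟨⟨fun i => u.left (i / 2), (true, u.state), fun i => u.right (i / 2)⟩,
          congrArg (fun u => G (φ u)) ?_⟩
        ext i
        · exact congrArg u.left (by omega)
        · rfl
        · exact congrArg u.right (by omega)

/-! ### Tapes with a marker -/

/-- The position of the first marked letter (`0` if there is none). -/
noncomputable def firstMark (p : ℕ → Bool) : ℕ := sInf {j | p j = true}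

theorem firstMark_spec {p : ℕ → Bool} (h : ∃ j, p j = true) : p (firstMark p) = true :=
  Nat.sInf_mem h

theorem firstMark_le {p : ℕ → Bool} {j : ℕ} (h : p j = true) : firstMark p ≤ j :=
  Nat.sInf_le h

theorem firstMark_of_zero {p : ℕ → Bool} (h : p 0 = true) : firstMark p = 0 :=
  Nat.le_zero.1 (firstMark_le h)

theorem firstMark_eq_of_agree {p p' : ℕ → Bool} {n m : ℕ} (hp : ∀ i < n, p i = p' i) (hm : m < n)
    (h : p m = true) : firstMark p' = firstMark p := by
  have h1 := firstMark_le h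
  have h' : p' m = true := hp m hm ▸ h
  have h2 := firstMark_le h'
  apply le_antisymm
  · apply firstMark_le
    rw [← hp _ (by omega)]
    exact firstMark_spec ⟨m, h⟩
  · apply firstMark_le
    rw [hp _ (by omega)]
    exact firstMark_spec ⟨m, h'⟩

/-- This makes the distance to a mark a clock: on the output tape `p'` is the later tape, on the
input tape the earlier one. -/
theorem firstMark_of_succ {p p' : ℕ → Bool} (h0 : p' 0 = false) (hs : ∀ i, p' (i + 1) = p i)
    (h : ∃ j, p j = true) : firstMark p' = firstMark p + 1 := by
  have h' : p' (firstMark p + 1) = true := by rw [hs]; exact firstMark_spec h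
  apply le_antisymm (firstMark_le h')
  rcases hk : firstMark p' with _ | k
  · have := firstMark_spec ⟨_, h'⟩
    rw [hk, h0] at this
    cases this
  · have := firstMark_spec ⟨_, h'⟩
    rw [hk, hs] at this
    exact Nat.succ_le_succ (firstMark_le this)

theorem exists_mark_succ {p p' : ℕ → Bool} (h0 : p' 0 = false) (hs : ∀ i, p' (i + 1) = p i) :
    (∃ j, p' j = true) ↔ ∃ j, p j = true := by
  constructor
  · rintro ⟨_ | j, h⟩
    · rw [h0] at h; cases h
    · exact ⟨j, hs j ▸ h⟩
  · rintro ⟨j, h⟩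
    exact ⟨j + 1, (hs j).trans h⟩

/-- The one-sided sequence read off a two-sided one `… l 1, l 0, q, r 0, r 1, …` by starting `k`
places to the left of `q`. -/
def unroll {α : Type} (k : ℕ) (l : ℕ → α) (q : α) (r : ℕ → α) (i : ℕ) : α :=
  if i < k then l (k - 1 - i) else if i = k then q else r (i - k - 1)

theorem unroll_zero {α : Type} (l : ℕ → α) (q : α) (r : ℕ → α) : unroll 0 l q r = push q r := by
  funext i
  rcases i with _ | i <;> simp [unroll]

/-- A step moves the first letter of the word one place further left, which `k + 1` compensates; so
the coded word is invariant. -/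
theorem unroll_succ {α : Type} (k : ℕ) {l l' : ℕ → α} {q q' : α} {r r' : ℕ → α}
    (hl : ∀ i, l' i = push q l i) (hq : q' = r 0) (hr : ∀ i, r' i = r (i + 1)) :
    unroll (k + 1) l' q' r' = unroll k l q r := by
  funext i
  unfold unroll
  rw [hq, hr, hl]
  rcases lt_trichotomy i k with h | rfl | h
  · rw [if_pos (show i < k + 1 by omega), if_pos h,
      show k + 1 - 1 - i = (k - 1 - i) + 1 by omega, push_succ]
  · simp
  · rw [if_neg (show ¬ i < k + 1 by omega), if_neg (show ¬ i < k by omega),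
      if_neg (show ¬ i = k by omega)]
    split_ifs with h'
    · exact congrArg r (by omega)
    · exact congrArg r (by omega)

theorem unroll_congr {α : Type} {k n i : ℕ} {l l' : ℕ → α} {q q' : α} {r r' : ℕ → α}
    (hl : ∀ i < n, l i = l' i) (hq : q = q') (hr : ∀ i < n, r i = r' i) (hk : k ≤ n)
    (hi : i ≤ n) : unroll k l q r i = unroll k l' q' r' i := by
  unfold unroll
  split_ifs with h1 h2
  · exact hl _ (by omega)
  · exact hq
  · exact hr _ (by omega)

/-! ### Attracted orbits -/

section Sink

/-- The automaton copying its input to its output without setting marks. -/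
def shiftAutomaton (α : Type) : FiniteAutomaton α α (Bool × α) where
  input _ a := a
  output q := (false, q)

open Classical in
/-- The sequence of letters starting after the last mark encodes the point in which the orbit
starts; without any mark the orbit rests at the limit. -/
noncomputable def sinkMap {α : Type} (G : ℝ → ℝ) (s : ℝ) (c : (ℕ → α) → ℝ)
    (u : Config α α (Bool × α)) : ℝ :=
  if ∃ j, (u.left j).1 = true then
    G^[firstMark fun j => (u.left j).1] (c (unroll (firstMark fun j => (u.left j).1)
      (fun i => (u.left i).2) u.state u.right))
  else s

/-- A step writes no mark: it keeps the coded word and advances the clock by one. -/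
theorem sinkMap_semiconj {α : Type} {G : ℝ → ℝ} {s : ℝ} {c : (ℕ → α) → ℝ} (hs : G s = s)
    (u : Config α α (Bool × α)) :
    G (sinkMap G s c u) = sinkMap G s c ((shiftAutomaton α).next u) := by
  unfold sinkMap
  have h0 : (((shiftAutomaton α).next u).left 0).1 = false := rfl
  have h1 : ∀ i, (((shiftAutomaton α).next u).left (i + 1)).1 = (u.left i).1 := fun i => rfl
  have hiff := exists_mark_succ (p := fun j => (u.left j).1)
    (p' := fun j => (((shiftAutomaton α).next u).left j).1) h0 h1
  by_cases h : ∃ j, (u.left j).1 = true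
  · rw [if_pos h, if_pos (hiff.2 h), firstMark_of_succ (p := fun j => (u.left j).1)
      (p' := fun j => (((shiftAutomaton α).next u).left j).1) h0 h1 h, iterate_succ_apply',
      unroll_succ (l := fun i => (u.left i).2) (q := u.state) (r := u.right)]
    · rintro (_ | i) <;> rfl
    · rfl
    · exact fun i => rfl
  · rw [if_neg h, if_neg (mt hiff.1 h), hs]

/-- Near a marked tape the clock is constant. Near an unmarked one any mark is far away, so the
value is `s` or a late iterate, uniformly close to `s`. -/
theorem isContinuous_sinkMap {α : Type} [TopologicalSpace α] [DiscreteTopology α] {G : ℝ → ℝ}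
    {s : ℝ} {c : (ℕ → α) → ℝ} (hG : Continuous G) (hc : Continuous c)
    (hlim : TendstoUniformlyOn (fun n => G^[n]) (fun _ => s) Filter.atTop (range c)) :
    Config.IsContinuous (sinkMap G s c) := by
  intro u ε hε
  by_cases h : ∃ j, (u.left j).1 = true
  · obtain ⟨j, hj⟩ := h
    set k := firstMark fun j => (u.left j).1 with hk
    set w := unroll k (fun i => (u.left i).2) u.state u.right
    have hopen : IsOpen ((fun w => G^[k] (c w)) ⁻¹' Metric.ball (G^[k] (c w)) ε) :=
      Metric.isOpen_ball.preimage ((hG.iterate k).comp hc)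
    obtain ⟨I, U, hU, hsub⟩ := isOpen_pi_iff.1 hopen w (Metric.mem_ball_self hε)
    refine ⟨max (j + 1) (I.sup id), fun v hv => ?_⟩
    have hvj : (v.left j).1 = true := by rw [← hv.left j (by omega)]; exact hj
    have hkv : (firstMark fun j => (v.left j).1) = k :=
      firstMark_eq_of_agree (fun i hi => congrArg Prod.fst (hv.left i hi)) (by omega) hj
    have hkj : k ≤ j := firstMark_le (p := fun j => (u.left j).1) hj
    unfold sinkMap
    rw [if_pos ⟨j, hvj⟩, if_pos ⟨j, hj⟩, hkv, ← hk]
    have : unroll k (fun i => (v.left i).2) v.state v.right ∈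
        (fun w => G^[k] (c w)) ⁻¹' Metric.ball (G^[k] (c w)) ε := by
      refine hsub fun i hi => ?_
      have hi' : i ≤ I.sup id := Finset.le_sup (f := id) hi
      rw [← unroll_congr (fun i hi => congrArg Prod.snd (hv.left i hi)) hv.state hv.right
        (by omega) (by omega)]
      exact (hU i hi).2
    exact this
  · obtain ⟨N, hN⟩ := Filter.eventually_atTop.1 (Metric.tendstoUniformlyOn_iff.1 hlim ε hε)
    refine ⟨N, fun v hv => ?_⟩
    unfold sinkMap
    rw [if_neg h]
    split_ifs with h'
    · have hle : N ≤ firstMark fun j => (v.left j).1 := by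
        by_contra! hlt
        refine h ⟨firstMark fun j => (v.left j).1, ?_⟩
        rw [hv.left _ hlt]
        exact firstMark_spec h'
      have := hN _ hle _ (mem_range_self (unroll (firstMark fun j => (v.left j).1)
        (fun i => (v.left i).2) v.state v.right))
      rwa [dist_comm] at this
    · simpa using hε

end Sink

/-! ### Repelled orbits -/

section Source

variable {A Q B B' : Type}

/-- The automaton `M` preceded by a waiting phase. In the phase `true` nothing happens until an
input letter tells to enter `M` at the state it names. The part of the output tape that `M` should
have seen on entering is interleaved into the rest of the input tape. -/
def FiniteAutomaton.delay (M : FiniteAutomaton A Q B) :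
    FiniteAutomaton (Bool × Q × A × B') (Bool × Q × B') (Bool × B × B') where
  input q a := bif q.1 then (!a.1, a.2.1, a.2.2.2) else (false, M.input q.2.1 a.2.2.1, a.2.2.2)
  output q := (q.1, M.output q.2.1, q.2.2)

/-- The configuration in which `M` is entered after reading the `n`-th letter. -/
def entryConfig (β : B' → B) (r : ℕ → Bool × Q × A × B') (n : ℕ) : Config A Q B where
  left i := β (r (n + i)).2.2.2
  state := (r n).2.1
  right i := (r (n + 1 + i)).2.2.1

open Classical in
/-- The configuration of `M` encoded by a configuration of the delayed automaton which is not
waiting. -/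
noncomputable def undelay (β : B' → B)
    (u : Config (Bool × Q × A × B') (Bool × Q × B') (Bool × B × B')) :
    Config A Q B where
  left m := if ∃ j ≤ m, (u.left j).1 = true then
      β (unroll (firstMark fun j => (u.left j).1) (fun i => (u.left i).2.2) u.state.2.2
        (fun i => (u.right i).2.2.2) (m - firstMark fun j => (u.left j).1))
    else (u.left m).2.1
  state := u.state.2.1
  right i := (u.right i).2.2.1

open Classical in
/-- While waiting, the point is the backward image under the inverse branch `h` of the point in
which `M` is going to be entered, or the limit `e` if it is never entered. -/
noncomputable def sourceMap (β : B' → B) (φ : Config A Q B → ℝ) (h : ℝ → ℝ) (e : ℝ)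
    (u : Config (Bool × Q × A × B') (Bool × Q × B') (Bool × B × B')) : ℝ :=
  if u.state.1 = true then
    if ∃ n, (u.right n).1 = true then
      h^[(firstMark fun n => (u.right n).1) + 1]
        (φ (entryConfig β u.right (firstMark fun n => (u.right n).1)))
    else e
  else φ (undelay β u)

/-- A waiting state writes a mark at distance 0, so the whole simulated output tape comes from the
`B'` track. -/
theorem undelay_next_of_waiting (M : FiniteAutomaton A Q B) (β : B' → B)
    (u : Config (Bool × Q × A × B') (Bool × Q × B') (Bool × B × B')) (hu : u.state.1 = true) :
    undelay β (M.delay.next u) = entryConfig β u.right 0 := by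
  have h0 : ((M.delay.next u).left 0).1 = true := hu
  ext i
  · simp only [undelay]
    rw [if_pos ⟨0, zero_le, h0⟩, firstMark_of_zero (p := fun j => ((M.delay.next u).left j).1) h0,
      unroll_zero]
    rcases i with _ | i
    · simp [entryConfig, FiniteAutomaton.next, FiniteAutomaton.delay, hu]
    · simp [entryConfig, FiniteAutomaton.next]
  · simp [undelay, entryConfig, FiniteAutomaton.next, FiniteAutomaton.delay, hu]
  · simp [undelay, entryConfig, FiniteAutomaton.next, add_comm]

/-- Cells newer than the last mark hold output of `M`, older ones are read from the `B'` track
counted from that mark; both kinds move along with the tapes. -/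
theorem undelay_next (M : FiniteAutomaton A Q B) (β : B' → B)
    (u : Config (Bool × Q × A × B') (Bool × Q × B') (Bool × B × B')) (hu : u.state.1 = false) :
    undelay β (M.delay.next u) = M.next (undelay β u) := by
  have h0 : ((M.delay.next u).left 0).1 = false := hu
  have h1 : ∀ i, ((M.delay.next u).left (i + 1)).1 = (u.left i).1 := fun i => rfl
  ext i
  · rcases i with _ | i
    · simp only [undelay]
      rw [if_neg]
      · rfl
      · rintro ⟨j, hj, h⟩
        rw [Nat.le_zero.1 hj, h0] at h
        cases h
    · have hiff : (∃ j ≤ i + 1, ((M.delay.next u).left j).1 = true) ↔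
          ∃ j ≤ i, (u.left j).1 = true := by
        constructor
        · rintro ⟨_ | j, hj, h⟩
          · rw [h0] at h; cases h
          · exact ⟨j, by omega, h⟩
        · rintro ⟨j, hj, h⟩
          exact ⟨j + 1, by omega, h⟩
      by_cases h : ∃ j ≤ i, (u.left j).1 = true
      · change (undelay β (M.delay.next u)).left (i + 1) = (undelay β u).left i
        simp only [undelay]
        rw [if_pos h, if_pos (hiff.2 h), firstMark_of_succ (p := fun j => (u.left j).1)
          (p' := fun j => ((M.delay.next u).left j).1) h0 h1 (h.imp fun _ => And.right),
          Nat.add_sub_add_right, unroll_succ (l := fun i => (u.left i).2.2) (q := u.state.2.2)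
          (r := fun i => (u.right i).2.2.2)]
        · rintro (_ | i) <;> rfl
        · simp [FiniteAutomaton.next, FiniteAutomaton.delay, hu]
        · exact fun i => rfl
      · change (undelay β (M.delay.next u)).left (i + 1) = (undelay β u).left i
        simp only [undelay]
        rw [if_neg h, if_neg (mt hiff.1 h)]
        rfl
  · simp [undelay, FiniteAutomaton.next, FiniteAutomaton.delay, hu]
  · rfl

theorem entryConfig_succ (β : B' → B) (r : ℕ → Bool × Q × A × B') (n : ℕ) :
    entryConfig β r (n + 1) = entryConfig β (fun i => r (i + 1)) n := by
  ext i
  · simp only [entryConfig]; congr 5; omega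
  · rfl
  · simp only [entryConfig]; congr 4; omega

/-- With the last mark at distance `k ≤ i`, cell `i` needs letter `i - k` of a word starting `k`
places to the left, so nothing beyond distance `n` is consulted. -/
theorem Config.Agree.undelay (β : B' → B) {n : ℕ}
    {u v : Config (Bool × Q × A × B') (Bool × Q × B') (Bool × B × B')} (h : u.Agree n v) :
    (undelay β u).Agree n (undelay β v) := by
  refine ⟨fun i hi => ?_, congrArg (fun q => q.2.1) h.state,
    fun i hi => congrArg (fun q => q.2.2.1) (h.right i hi)⟩
  have hiff : (∃ j ≤ i, (u.left j).1 = true) ↔ ∃ j ≤ i, (v.left j).1 = true :=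
    exists_congr fun j => and_congr_right fun hj => by rw [h.left j (by omega)]
  simp only [_root_.undelay]
  by_cases hm : ∃ j ≤ i, (u.left j).1 = true
  · obtain ⟨j, hji, hj⟩ := hm
    rw [if_pos ⟨j, hji, hj⟩, if_pos (hiff.1 ⟨j, hji, hj⟩), firstMark_eq_of_agree
      (p := fun j => (u.left j).1) (fun i hi => congrArg Prod.fst (h.left i hi)) (by omega) hj]
    have := firstMark_le (p := fun j => (u.left j).1) hj
    exact congrArg β (unroll_congr (fun i hi => congrArg (fun q => q.2.2) (h.left i hi))
      (congrArg (fun q => q.2.2) h.state) (fun i hi => congrArg (fun q => q.2.2.2) (h.right i hi))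
      (by omega) (by omega))
  · rw [if_neg hm, if_neg (mt hiff.2 hm), h.left i hi]

variable {M : FiniteAutomaton A Q B} {β : B' → B} {φ : Config A Q B → ℝ} {G h : ℝ → ℝ} {e : ℝ}
  {P : Set ℝ}

/-- Each waiting step brings the entry letter one place nearer and so strips one `h`, which is what
`G` does on `h(P)`. -/
theorem sourceMap_semiconj (hφ : ∀ u, G (φ u) = φ (M.next u)) (he : G e = e)
    (hP : MapsTo h P P) (hh : ∀ x ∈ P, G (h x) = x)
    (hentry : ∀ u, (∀ i, u.left i ∈ range β) → φ u ∈ P)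
    (u : Config (Bool × Q × A × B') (Bool × Q × B') (Bool × B × B')) :
    G (sourceMap β φ h e u) = sourceMap β φ h e (M.delay.next u) := by
  have hmem : ∀ n, φ (entryConfig β u.right n) ∈ P := fun n =>
    hentry _ fun i => mem_range_self _
  by_cases hu : u.state.1 = true
  · by_cases h0 : (u.right 0).1 = true
    · have hs : ¬ (M.delay.next u).state.1 = true := by
        simp [FiniteAutomaton.next, FiniteAutomaton.delay, hu, h0]
      simp only [sourceMap]
      rw [if_pos hu, if_neg hs, if_pos ⟨0, h0⟩, undelay_next_of_waiting M β u hu,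
        firstMark_of_zero (p := fun n => (u.right n).1) h0]
      exact hh _ (hmem 0)
    · have hs : (M.delay.next u).state.1 = true := by
        simp [FiniteAutomaton.next, FiniteAutomaton.delay, hu, h0]
      have h1 : (u.right 0).1 = false := by simpa using h0
      have hiff := exists_mark_succ (p' := fun n => (u.right n).1)
        (p := fun n => ((M.delay.next u).right n).1) h1 fun i => rfl
      simp only [sourceMap]
      rw [if_pos hu, if_pos hs]
      by_cases hex : ∃ n, (u.right n).1 = true
      · rw [if_pos hex, if_pos (hiff.1 hex), firstMark_of_succ (p' := fun n => (u.right n).1)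
          (p := fun n => ((M.delay.next u).right n).1) h1 (fun i => rfl) (hiff.1 hex),
          iterate_succ_apply', hh _ (hP.iterate _ (hmem _)), entryConfig_succ]
        rfl
      · rw [if_neg hex, if_neg (mt hiff.2 hex), he]
  · have hs : ¬ (M.delay.next u).state.1 = true := by
      simp [FiniteAutomaton.next, FiniteAutomaton.delay, hu]
    simp only [sourceMap]
    rw [if_neg hu, if_neg hs, hφ, undelay_next M β u (by simpa using hu)]

/-- The critical tapes are those without entry letter: nearby ones apply `h` many times to an entry
point, or have value `e`. -/
theorem isContinuous_sourceMap (hφ : Config.IsContinuous φ) (hc : Continuous h)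
    (hlim : TendstoUniformlyOn (fun n => h^[n]) (fun _ => e) Filter.atTop
      {x | ∃ u, (∀ i, u.left i ∈ range β) ∧ φ u = x}) :
    Config.IsContinuous (sourceMap β φ h e) := by
  intro u ε hε
  by_cases hu : u.state.1 = true
  · by_cases hex : ∃ n, (u.right n).1 = true
    · obtain ⟨j, hj⟩ := hex
      set k := firstMark fun n => (u.right n).1 with hk
      have hkj : k ≤ j := firstMark_le (p := fun n => (u.right n).1) hj
      obtain ⟨n, hn⟩ := hφ.comp (hc.iterate (k + 1)) (entryConfig β u.right k) ε hε
      refine ⟨j + 1 + n, fun v hv => ?_⟩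
      have hvj : (v.right j).1 = true := by rw [← hv.right j (by omega)]; exact hj
      have hkv : (firstMark fun n => (v.right n).1) = k :=
        firstMark_eq_of_agree (fun i hi => congrArg Prod.fst (hv.right i hi)) (by omega) hj
      simp only [sourceMap]
      rw [if_pos hu, if_pos (hv.state ▸ hu), if_pos ⟨j, hvj⟩, if_pos ⟨j, hj⟩, hkv, ← hk]
      exact hn _ ⟨fun i hi =>
          congrArg (fun q : Bool × Q × A × B' => β q.2.2.2) (hv.right (k + i) (by omega)),
        congrArg (fun q => q.2.1) (hv.right k (by omega)),
        fun i hi => congrArg (fun q => q.2.2.1) (hv.right (k + 1 + i) (by omega))⟩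
    · obtain ⟨N, hN⟩ := Filter.eventually_atTop.1 (Metric.tendstoUniformlyOn_iff.1 hlim ε hε)
      refine ⟨N, fun v hv => ?_⟩
      simp only [sourceMap]
      rw [if_pos hu, if_pos (hv.state ▸ hu), if_neg hex]
      split_ifs with h'
      · have hle : N ≤ firstMark fun n => (v.right n).1 := by
          by_contra! hlt
          refine hex ⟨firstMark fun n => (v.right n).1, ?_⟩
          rw [hv.right _ hlt]
          exact firstMark_spec h'
        have := hN _ (hle.trans (Nat.le_succ _)) _
          ⟨entryConfig β v.right (firstMark fun n => (v.right n).1), fun i => mem_range_self _, rfl⟩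
        rwa [dist_comm] at this
      · simpa using hε
  · obtain ⟨n, hn⟩ := hφ (undelay β u) ε hε
    refine ⟨n, fun v hv => ?_⟩
    simp only [sourceMap]
    rw [if_neg hu, if_neg (hv.state ▸ hu)]
    exact hn _ (hv.undelay β)

/-- Backward orbits under an inverse branch which converge to a fixed point `e` can be added to a
presented set. -/
theorem covers_source [Finite A] [Finite Q] [Finite B] [Finite B'] [Nonempty A] [Nonempty Q]
    [Nonempty B] [Nonempty B'] (hφ : Config.IsContinuous φ) (hM : ∀ u, G (φ u) = φ (M.next u))
    (he : G e = e) (hc : Continuous h) (hP : MapsTo h P P) (hh : ∀ x ∈ P, G (h x) = x)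
    (hentry : ∀ u, (∀ i, u.left i ∈ range β) → φ u ∈ P)
    (hlim : TendstoUniformlyOn (fun n => h^[n]) (fun _ => e) Filter.atTop
      {x | ∃ u, (∀ i, u.left i ∈ range β) ∧ φ u = x}) :
    Covers G (range φ ∪ {e} ∪
      {x | ∃ n u, (∀ i, u.left i ∈ range β) ∧ h^[n] (φ u) = x}) := by
  refine ⟨_, ?_, _, _, _, inferInstance, inferInstance, inferInstance, inferInstance,
    inferInstance, inferInstance, M.delay, sourceMap β φ h e, isContinuous_sourceMap hφ hc hlim,
    sourceMap_semiconj hM he hP hh hentry, rfl⟩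
  obtain ⟨a⟩ := ‹Nonempty A›
  obtain ⟨q⟩ := ‹Nonempty Q›
  obtain ⟨b⟩ := ‹Nonempty B›
  obtain ⟨b'⟩ := ‹Nonempty B'›
  have hrange : ∀ u, φ u ∈ range (sourceMap β φ h e) := fun u => by
    refine ⟨⟨fun i => (false, u.left i, b'), (false, u.state, b'),
      fun i => (false, q, u.right i, b')⟩, ?_⟩
    simp only [sourceMap]
    rw [if_neg (by simp)]
    congr 1
    ext i
    · simp [undelay]
    · rfl
    · rfl
  rintro x ((⟨u, rfl⟩ | rfl) | ⟨n, u, hu, rfl⟩)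
  · exact hrange u
  · exact ⟨⟨fun _ => (false, b, b'), (true, q, b'), fun _ => (false, q, a, b')⟩,
      by simp [sourceMap]⟩
  -- A waiting configuration applies `h` at least once, so exponent 0 is left to running
  -- configurations.
  · rcases n with _ | n
    · exact hrange u
    · choose w hw using hu
      -- The first entry letter is at place `n`; the output track starts there, the input track one
      -- place later.
      let r : ℕ → Bool × Q × A × B' := fun i =>
        (decide (n ≤ i), u.state, u.right (i - (n + 1)), w (i - n))
      have hn : (r n).1 = true := by simp [r]
      have hk : (firstMark fun i => (r i).1) = n := by
        refine le_antisymm (firstMark_le hn) ?_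
        simpa [r] using firstMark_spec (p := fun i => (r i).1) ⟨n, hn⟩
      refine ⟨⟨fun _ => (false, b, b'), (true, q, b'), r⟩, ?_⟩
      simp only [sourceMap]
      rw [if_pos trivial, if_pos ⟨n, hn⟩, hk]
      congr 2
      ext i
      · simp [entryConfig, r, hw]
      · rfl
      · simp [entryConfig, r]

end Source

/-! ### Iteration of increasing maps -/

-- The orbit decreases and stays above `a`; its limit is a fixed point in `[a, x]`, hence `a`.
open Filter in
theorem tendsto_iterate_of_lt {K : ℝ → ℝ} (hK : Continuous K) (hm : Monotone K) {a x : ℝ}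
    (hax : a ≤ x) (ha : K a = a) (h : ∀ y, a < y → y ≤ x → K y < y) :
    Tendsto (fun n => K^[n] x) atTop (nhds a) := by
  have hle : K x ≤ x := by
    rcases hax.eq_or_lt with rfl | h'
    · exact ha.le
    · exact (h x h' le_rfl).le
  have hanti : Antitone fun n => K^[n] x := hm.antitone_iterate_of_map_le hle
  have hlow : ∀ n, a ≤ K^[n] x := fun n => by
    simpa [iterate_fixed ha n] using hm.iterate n hax
  have hlim := tendsto_atTop_ciInf hanti ⟨a, by rintro _ ⟨n, rfl⟩; exact hlow n⟩
  set L := ⨅ n, K^[n] x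
  have hfix : K L = L := isFixedPt_of_tendsto_iterate hlim hK.continuousAt
  have h1 : a ≤ L := ge_of_tendsto' hlim hlow
  have h2 : L ≤ x := hanti.le_of_tendsto hlim 0
  rcases h1.eq_or_lt with h' | h'
  · rwa [h']
  · exact absurd hfix (h L h' h2).ne

open Filter in
theorem tendsto_iterate_of_gt {K : ℝ → ℝ} (hK : Continuous K) (hm : Monotone K) {b x : ℝ}
    (hxb : x ≤ b) (hb : K b = b) (h : ∀ y, y < b → x ≤ y → y < K y) :
    Tendsto (fun n => K^[n] x) atTop (nhds b) := by
  have hle : x ≤ K x := by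
    rcases hxb.eq_or_lt with rfl | h'
    · exact hb.ge
    · exact (h x h' le_rfl).le
  have hmono : Monotone fun n => K^[n] x := hm.monotone_iterate_of_le_map hle
  have hup : ∀ n, K^[n] x ≤ b := fun n => by
    simpa [iterate_fixed hb n] using hm.iterate n hxb
  have hlim := tendsto_atTop_ciSup hmono ⟨b, by rintro _ ⟨n, rfl⟩; exact hup n⟩
  set L := ⨆ n, K^[n] x
  have hfix : K L = L := isFixedPt_of_tendsto_iterate hlim hK.continuousAt
  have h1 : L ≤ b := le_of_tendsto' hlim hup
  have h2 : x ≤ L := hmono.ge_of_tendsto hlim 0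
  rcases h1.eq_or_lt with h' | h'
  · rwa [← h']
  · exact absurd hfix.symm (h L h' h2).ne

-- Monotone iterates on the interval are squeezed between those of its end points.
open Filter in
theorem tendstoUniformlyOn_iterate_Icc {K : ℝ → ℝ} (hm : Monotone K) {x y e : ℝ}
    (hx : Tendsto (fun n => K^[n] x) atTop (nhds e))
    (hy : Tendsto (fun n => K^[n] y) atTop (nhds e)) :
    TendstoUniformlyOn (fun n => K^[n]) (fun _ => e) atTop (Icc x y) := by
  refine Metric.tendstoUniformlyOn_iff.2 fun ε hε => ?_
  filter_upwards [Metric.tendsto_nhds.1 hx ε hε, Metric.tendsto_nhds.1 hy ε hε] with n h1 h2 z hz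
  rw [Real.dist_eq, abs_lt] at *
  have := hm.iterate n hz.1
  have := hm.iterate n hz.2
  constructor <;> linarith

theorem OrderIso.symm_iterate_le_iff (K : ℝ ≃o ℝ) (n : ℕ) (x y : ℝ) :
    K.symm^[n] x ≤ y ↔ x ≤ K^[n] y := by
  induction n generalizing x y with
  | zero => rfl
  | succ n ih => rw [iterate_succ_apply', iterate_succ_apply, K.symm_apply_le, ih]

theorem OrderIso.le_symm_iterate_iff (K : ℝ ≃o ℝ) (n : ℕ) (x y : ℝ) :
    y ≤ K.symm^[n] x ↔ K^[n] y ≤ x := by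
  induction n generalizing x y with
  | zero => rfl
  | succ n ih => rw [iterate_succ_apply', iterate_succ_apply, K.le_symm_apply, ih]

open Filter in
/-- The orbit of a point between the repelling fixed point `a` and `K x₀` meets the fundamental
domain `[x₀, K x₀]`. -/
theorem OrderIso.exists_iterate_mem_Icc (K : ℝ ≃o ℝ) {a x₀ x : ℝ}
    (hlim : Tendsto (fun n => K.symm^[n] x₀) atTop (nhds a)) (hax : a < x) (hx : x ≤ K x₀) :
    ∃ n, K^[n] x ∈ Icc x₀ (K x₀) := by
  have hex : ∃ n, K.symm^[n] x₀ ≤ x := (hlim.eventually_le_const hax).exists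
  classical
  refine ⟨Nat.find hex, (K.symm_iterate_le_iff _ _ _).1 (Nat.find_spec hex), ?_⟩
  -- By minimality the preceding iterate lies below `x₀`, hence this one below `K x₀`.
  rcases h : Nat.find hex with _ | n
  · exact hx
  · have := Nat.find_min hex (m := n) (by omega)
    rw [K.symm_iterate_le_iff, not_le] at this
    rw [iterate_succ_apply']
    exact K.monotone this.le

open Filter in
/-- The backward orbit of a point between `x₀` and the attracting fixed point `b` meets the
fundamental domain `[x₀, K x₀]`. -/
theorem OrderIso.exists_symm_iterate_mem_Icc (K : ℝ ≃o ℝ) {b x₀ x : ℝ}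
    (hlim : Tendsto (fun n => K^[n] x₀) atTop (nhds b)) (hxb : x < b) (hx : x₀ ≤ x) :
    ∃ n, K.symm^[n] x ∈ Icc x₀ (K x₀) := by
  have hex : ∃ n, x ≤ K^[n + 1] x₀ :=
    ((hlim.comp (tendsto_add_atTop_nat 1)).eventually_const_le hxb).exists
  classical
  refine ⟨Nat.find hex, ?_, ?_⟩
  · rcases h : Nat.find hex with _ | n
    · exact hx
    · have := Nat.find_min hex (m := n) (by omega)
      rw [K.le_symm_iterate_iff]
      exact (not_le.1 this).le
  · rw [K.symm_iterate_le_iff, ← iterate_succ_apply]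
    exact Nat.find_spec hex

open Filter in
/-- A strictly increasing continuous function on an interval extends to a homeomorphism of the
line. -/
theorem exists_orderIso_eqOn_Icc {f : ℝ → ℝ} {a b : ℝ} (hab : a ≤ b)
    (hf : ContinuousOn f (Icc a b)) (hm : StrictMonoOn f (Icc a b)) :
    ∃ K : ℝ ≃o ℝ, EqOn K f (Icc a b) := by
  let c : ℝ → ℝ := fun x => projIcc a b hab x
  have hcc : Continuous c := continuous_subtype_val.comp continuous_projIcc
  have hc : ∀ x, c x ∈ Icc a b := fun x => (projIcc a b hab x).2
  have hcm : Monotone c := fun x y h => monotone_projIcc hab h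
  have hc' : Monotone fun x => x - c x := by
    intro x y h
    simp only [c, coe_projIcc]
    rcases min_cases b x with h1 | h1 <;> rcases min_cases b y with h2 | h2 <;>
    rcases max_cases a (min b x) with h3 | h3 <;> rcases max_cases a (min b y) with h4 | h4 <;>
    linarith
  -- Outside `[a, b]` the graph continues with slope one.
  let F : ℝ → ℝ := fun x => f (c x) + (x - c x)
  have hFm : StrictMono F := by
    intro x y h
    rcases (hcm h.le).lt_or_eq with h1 | h1
    · exact add_lt_add_of_lt_of_le (hm (hc x) (hc y) h1) (hc' h.le)
    · simp only [F, h1]; linarith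
  have hFc : Continuous F :=
    ((hf.comp_continuous hcc hc)).add (continuous_id.sub hcc)
  have hlow : ∀ x, f a + (x - b) ≤ F x := fun x =>
    add_le_add (hm.monotoneOn ⟨le_rfl, hab⟩ (hc x) (hc x).1) (by linarith [(hc x).2])
  have hup : ∀ x, F x ≤ f b + (x - a) := fun x =>
    add_le_add (hm.monotoneOn (hc x) ⟨hab, le_rfl⟩ (hc x).2) (by linarith [(hc x).1])
  have hs : Surjective F := hFc.surjective
    (tendsto_atTop_mono hlow (tendsto_atTop_add_const_left _ _
      (tendsto_atTop_add_const_right _ _ tendsto_id)))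
    (tendsto_atBot_mono hup (tendsto_atBot_add_const_left _ _
      (tendsto_atBot_add_const_right _ _ tendsto_id)))
  refine ⟨hFm.orderIsoOfSurjective F hs, fun x hx => ?_⟩
  have : c x = x := by simp only [c, projIcc_of_mem hab hx]
  simp [F, this]

/-! ### Intervals between fixed points -/

open Filter in
/-- A system which agrees with an increasing homeomorphism `H` on an interval is presented on the
full orbit under `H` of an interval that is attracted by `s` and repelled by `e`. -/
theorem covers_fullOrbit {G : ℝ → ℝ} (hG : Continuous G) (H : ℝ ≃o ℝ) {a b s e x₀ x₁ : ℝ}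
    (hGH : EqOn G H (Icc a b)) (ha : H a = a) (hb : H b = b) (hs : s ∈ Icc a b) (he : e ∈ Icc a b)
    (hHs : H s = s) (hHe : H e = e) (h₀ : a ≤ x₀) (h₀₁ : x₀ ≤ x₁) (h₁ : x₁ ≤ b)
    (hs₀ : Tendsto (fun n => H^[n] x₀) atTop (nhds s))
    (hs₁ : Tendsto (fun n => H^[n] x₁) atTop (nhds s))
    (he₀ : Tendsto (fun n => H.symm^[n] x₀) atTop (nhds e))
    (he₁ : Tendsto (fun n => H.symm^[n] x₁) atTop (nhds e)) :
    Covers G ({s, e} ∪ {x | ∃ n, H^[n] x ∈ Icc x₀ x₁ ∨ H.symm^[n] x ∈ Icc x₀ x₁}) := by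
  have hsub : Icc x₀ x₁ ⊆ Icc a b := Icc_subset_Icc h₀ h₁
  have hmaps : MapsTo H (Icc a b) (Icc a b) := fun x hx =>
    ⟨ha ▸ H.monotone hx.1, hb ▸ H.monotone hx.2⟩
  have hmaps' : MapsTo H.symm (Icc a b) (Icc a b) := fun x hx =>
    ⟨H.le_symm_apply.2 (ha.symm ▸ hx.1), H.symm_apply_le.2 (hb.symm ▸ hx.2)⟩
  have hiter : ∀ n, EqOn G^[n] H^[n] (Icc a b) := by
    intro n
    induction n with
    | zero => exact fun x _ => rfl
    | succ n ih =>
      intro x hx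
      rw [iterate_succ_apply', iterate_succ_apply', ih hx, hGH (hmaps.iterate n hx)]
  have : Nonempty (Icc x₀ x₁) := ⟨⟨x₀, le_rfl, h₀₁⟩⟩
  obtain ⟨c', hc', hsurj⟩ := exists_nat_bool_continuous_surjective_of_compact (Icc x₀ x₁)
  let c : (ℕ → Bool) → ℝ := fun w => c' w
  have hc : Continuous c := continuous_subtype_val.comp hc'
  have hcr : range c ⊆ Icc x₀ x₁ := by
    rintro _ ⟨w, rfl⟩
    exact (c' w).2
  have hGs : G s = s := (hGH hs).trans hHs
  have hGe : G e = e := (hGH he).trans hHe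
  have hlim : TendstoUniformlyOn (fun n => G^[n]) (fun _ => s) atTop (range c) :=
    ((tendstoUniformlyOn_iterate_Icc H.monotone hs₀ hs₁).congr (Eventually.of_forall
      fun n x hx => (hiter n (hsub hx)).symm)).mono hcr
  -- On entry the output tape is marked everywhere, so the clock reads 0 and the value lies in `[x₀,
  -- x₁]`. Unrestricted tapes would also give `s`, which `H.symm` fixes.
  let β : Unit → Bool × Bool := fun _ => (true, false)
  have hentry : ∀ u : Config Bool Bool (Bool × Bool), (∀ i, u.left i ∈ range β) →
      sinkMap G s c u = c (push u.state u.right) := by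
    intro u hu
    obtain ⟨_, h⟩ := hu 0
    have h0 : (u.left 0).1 = true := by rw [← h]
    unfold sinkMap
    rw [if_pos ⟨0, h0⟩, firstMark_of_zero (p := fun j => (u.left j).1) h0, unroll_zero]
    rfl
  have hentry' : ∀ u : Config Bool Bool (Bool × Bool), (∀ i, u.left i ∈ range β) →
      sinkMap G s c u ∈ Icc x₀ x₁ := fun u hu => by
    rw [hentry u hu]
    exact hcr (mem_range_self _)
  have hex : ∀ y ∈ Icc x₀ x₁, ∃ u : Config Bool Bool (Bool × Bool), (∀ i, u.left i ∈ range β) ∧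
      sinkMap G s c u = y := by
    intro y hy
    obtain ⟨w, hw⟩ := hsurj ⟨y, hy⟩
    have hu : ∀ i : ℕ, (fun _ => (true, false) : ℕ → Bool × Bool) i ∈ range β :=
      fun i => ⟨(), rfl⟩
    refine ⟨⟨fun _ => (true, false), w 0, fun i => w (i + 1)⟩, hu, ?_⟩
    rw [hentry _ hu]
    have : push (w 0) (fun i => w (i + 1)) = w := by
      funext i
      rcases i with _ | i <;> rfl
    simp only [this, c, hw]
  refine (covers_source (h := H.symm) (P := Icc a b) (isContinuous_sinkMap hG hc hlim)
    (sinkMap_semiconj hGs) hGe H.symm.continuous hmaps'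
    (fun x hx => (hGH (hmaps' hx)).trans (H.apply_symm_apply x))
    (fun u hu => hsub (hentry' u hu))
    ((tendstoUniformlyOn_iterate_Icc H.symm.monotone he₀ he₁).mono ?_)).mono ?_
  · rintro x ⟨u, hu, rfl⟩
    exact hentry' u hu
  · rintro x ((rfl | rfl) | ⟨n, hn | hn⟩)
    · exact Or.inl (Or.inl ⟨⟨fun _ => (false, false), false, fun _ => false⟩, by simp [sinkMap]⟩)
    · exact Or.inl (Or.inr rfl)
    · obtain ⟨u, hu, hux⟩ := hex _ hn
      refine Or.inr ⟨n, u, hu, ?_⟩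
      rw [hux]
      exact (LeftInverse.iterate H.symm_apply_apply n) x
    · obtain ⟨u, hu, hux⟩ := hex _ hn
      -- Forward images of the fundamental domain are reached by running the sink automaton.
      refine Or.inl (Or.inl ⟨(shiftAutomaton Bool).next^[n] u, ?_⟩)
      have hsemi : Semiconj (sinkMap G s c) (shiftAutomaton Bool).next G := fun u =>
        (sinkMap_semiconj hGs u).symm
      rw [(hsemi.iterate_right n).eq, hux, hiter n (hsub hn)]
      exact (LeftInverse.iterate H.apply_symm_apply n) x

/-- A system which is increasing on the interval between two adjacent fixed points is presented on
that interval. -/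
theorem covers_Icc_of_fixed {G : ℝ → ℝ} (hG : Continuous G) {a b : ℝ} (hab : a < b)
    (hm : StrictMonoOn G (Icc a b)) (ha : G a = a) (hb : G b = b)
    (hne : ∀ x ∈ Ioo a b, G x ≠ x) : Covers G (Icc a b) := by
  obtain ⟨H, hH⟩ := exists_orderIso_eqOn_Icc hab.le hG.continuousOn hm
  have hHa : H a = a := (hH ⟨le_rfl, hab.le⟩).trans ha
  have hHb : H b = b := (hH ⟨hab.le, le_rfl⟩).trans hb
  have hHa' : H.symm a = a := by rw [H.symm_apply_eq, hHa]
  have hHb' : H.symm b = b := by rw [H.symm_apply_eq, hHb]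
  obtain ⟨x₀, h0a, h0b⟩ := exists_between hab
  -- `K` will be `H` or `H.symm`, whichever moves points up.
  have orbit : ∀ K : ℝ ≃o ℝ, K a = a → K b = b → (∀ x ∈ Ioo a b, x < K x) →
      Filter.Tendsto (fun n => K^[n] x₀) Filter.atTop (nhds b) ∧
      Filter.Tendsto (fun n => K^[n] (K x₀)) Filter.atTop (nhds b) ∧
      Filter.Tendsto (fun n => K.symm^[n] x₀) Filter.atTop (nhds a) ∧
      Filter.Tendsto (fun n => K.symm^[n] (K x₀)) Filter.atTop (nhds a) ∧
      a ≤ x₀ ∧ x₀ ≤ K x₀ ∧ K x₀ ≤ b ∧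
      ∀ x ∈ Ioo a b, ∃ n, K^[n] x ∈ Icc x₀ (K x₀) ∨ K.symm^[n] x ∈ Icc x₀ (K x₀) := by
    intro K hKa hKb hK
    have hKs : ∀ x, a < x → x < b → K.symm x < x := fun x h1 h2 =>
      K.symm_apply_lt.2 (hK x ⟨h1, h2⟩)
    have hKa' : K.symm a = a := by rw [K.symm_apply_eq, hKa]
    have h1b : K x₀ < b := hKb ▸ K.strictMono h0b
    have h01 := hK x₀ ⟨h0a, h0b⟩
    have l1 := tendsto_iterate_of_gt K.continuous K.monotone h0b.le hKb
      fun y h1 h2 => hK y ⟨h0a.trans_le h2, h1⟩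
    have l2 := tendsto_iterate_of_lt K.symm.continuous K.symm.monotone h0a.le hKa'
      fun y h1 h2 => hKs y h1 (h2.trans_lt h0b)
    refine ⟨l1, tendsto_iterate_of_gt K.continuous K.monotone h1b.le hKb
      fun y h1 h2 => hK y ⟨(h0a.trans h01).trans_le h2, h1⟩, l2,
      tendsto_iterate_of_lt K.symm.continuous K.symm.monotone (h0a.trans h01).le hKa'
      fun y h1 h2 => hKs y h1 (h2.trans_lt h1b), h0a.le, h01.le, h1b.le, fun x hx => ?_⟩
    rcases le_total x (K x₀) with h | h
    · exact (K.exists_iterate_mem_Icc l2 hx.1 h).imp fun _ => Or.inl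
    · exact (K.exists_symm_iterate_mem_Icc l1 hx.2 (h01.le.trans h)).imp fun _ => Or.inr
  have hsign : (∀ x ∈ Ioo a b, x < H x) ∨ (∀ x ∈ Ioo a b, x < H.symm x) := by
    by_contra! hcon
    obtain ⟨⟨x, hx, hxl⟩, y, hy, hyl⟩ := hcon
    have hyl' : y ≤ H y := H.symm_apply_le.1 hyl
    have hsub : uIcc x y ⊆ Ioo a b := ordConnected_Ioo.uIcc_subset hx hy
    have hcont : ContinuousOn (fun z => H z - z) (uIcc x y) :=
      (H.continuous.sub continuous_id).continuousOn
    have hmem : (0 : ℝ) ∈ uIcc (H x - x) (H y - y) :=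
      mem_uIcc.2 (Or.inl ⟨by linarith, by linarith⟩)
    obtain ⟨z, hz, hz0⟩ := intermediate_value_uIcc hcont hmem
    have hz' := hsub hz
    refine hne z hz' ?_
    rw [← hH ⟨hz'.1.le, hz'.2.le⟩]
    exact sub_eq_zero.1 hz0
  have final : ∀ s e x₁, Covers G ({s, e} ∪ {x | ∃ n, H^[n] x ∈ Icc x₀ x₁ ∨
      H.symm^[n] x ∈ Icc x₀ x₁}) → ({a, b} : Set ℝ) ⊆ {s, e} →
      (∀ x ∈ Ioo a b, ∃ n, H^[n] x ∈ Icc x₀ x₁ ∨ H.symm^[n] x ∈ Icc x₀ x₁) →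
      Covers G (Icc a b) := by
    intro s e x₁ hcov hse h
    refine hcov.mono fun x hx => ?_
    rcases hx.1.eq_or_lt with rfl | h1
    · exact Or.inl (hse (by simp))
    · rcases hx.2.eq_or_lt with rfl | h2
      · exact Or.inl (hse (by simp))
      · exact Or.inr (h x ⟨h1, h2⟩)
  have hal : a ∈ Icc a b := ⟨le_rfl, hab.le⟩
  have hbl : b ∈ Icc a b := ⟨hab.le, le_rfl⟩
  rcases hsign with h | h
  · obtain ⟨l1, l2, l3, l4, i1, i2, i3, hex⟩ := orbit H hHa hHb h
    exact final _ _ _ (covers_fullOrbit hG H hH.symm hHa hHb hbl hal hHb hHa i1 i2 i3 l1 l2 l3 l4)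
      (pair_comm b a).ge hex
  · obtain ⟨l1, l2, l3, l4, i1, i2, i3, hex⟩ := orbit H.symm hHa' hHb' h
    exact final _ _ _ (covers_fullOrbit hG H hH.symm hHa hHb hal hbl hHa hHb i1 i2 i3 l3 l4 l1 l2)
      Subset.rfl fun x hx => (hex x hx).imp fun _ => Or.symm

/-- A system which is increasing on an interval with only finitely many fixed points is presented
on the interval between any two of these points. -/
theorem covers_Icc_of_finite_fixed {G : ℝ → ℝ} (hG : Continuous G) {a b : ℝ} (hab : a ≤ b)
    (hm : StrictMonoOn G (Icc a b)) (ha : G a = a) (hb : G b = b)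
    (hfin : {x | x ∈ Icc a b ∧ G x = x}.Finite) : Covers G (Icc a b) := by
  set F := {x | x ∈ Icc a b ∧ G x = x} with hF
  let I : Set (ℝ × ℝ) := {q | q ∈ F ×ˢ F ∧ q.1 < q.2 ∧ ∀ x ∈ Ioo q.1 q.2, G x ≠ x}
  have hI : I.Finite := (hfin.prod hfin).subset fun q hq => hq.1
  -- The point `b` is added by hand, because the search below needs a fixed point strictly above
  -- `x`.
  have hcov : Covers G ({b} ∪ ⋃ q ∈ I, Icc q.1 q.2) := by
    refine Covers.union ⟨{b}, Subset.rfl, presents_singleton hb⟩ (Covers.biUnion hb hI ?_)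
    rintro ⟨c, d⟩ ⟨⟨hc, hd⟩, hcd, hne⟩
    exact covers_Icc_of_fixed hG hcd (hm.mono (Icc_subset_Icc hc.1.1 hd.1.2)) hc.2 hd.2 hne
  refine hcov.mono fun x hx => ?_
  rcases hx.2.eq_or_lt with rfl | hxb
  · exact Or.inl rfl
  have h1 : (F ∩ Iic x).Finite := hfin.subset inter_subset_left
  have h2 : (F ∩ Ioi x).Finite := hfin.subset inter_subset_left
  obtain ⟨c, hc, hcmax⟩ := h1.exists_maximal ⟨a, ⟨⟨le_rfl, hab⟩, ha⟩, hx.1⟩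
  obtain ⟨d, hd, hdmin⟩ := h2.exists_minimal ⟨b, ⟨⟨hab, le_rfl⟩, hb⟩, hxb⟩
  refine Or.inr (mem_biUnion (x := (c, d)) ⟨⟨hc.1, hd.1⟩, lt_of_le_of_lt hc.2 hd.2, ?_⟩
    ⟨hc.2, le_of_lt hd.2⟩)
  intro y hy hfix
  have hyF : y ∈ F := ⟨⟨hc.1.1.1.trans hy.1.le, hy.2.le.trans hd.1.1.2⟩, hfix⟩
  rcases le_or_gt y x with h | h
  · exact absurd (hcmax ⟨hyF, h⟩ hy.1.le) hy.1.not_ge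
  · exact absurd (hdmin ⟨hyF, h⟩ hy.2.le) hy.2.not_ge

/-! ### Unimodal systems -/

theorem FiniteAutomaton.next_toDiscontinuum_semiconj {A Q B : Type} {Y : Type*} {g : Y → Y}
    {M : FiniteAutomaton A Q B} {φ : Discontinuum A Q B → Y} (h : ∀ x, g (φ x) = φ (M.step x))
    (u : Config A Q B) : g (φ u.toDiscontinuum) = φ (M.next u).toDiscontinuum := by
  rw [h, Config.toDiscontinuum_next]

/-- A system on an interval `[a, b]` is a factor of a finite automaton if its extension to the
line, constant outside of `[a, b]`, is presented on a set containing `[a, b]`. -/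
theorem Covers.isFactorOfFiniteAutomaton {g : ℝ → ℝ} {a b : ℝ} (hab : a ≤ b)
    (hg : MapsTo g (Icc a b) (Icc a b))
    (h : Covers (fun x => g (projIcc a b hab x)) (Icc a b)) :
    IsFactorOfFiniteAutomaton (hg.restrict g (Icc a b) (Icc a b)) := by
  obtain ⟨S, hS, A, Q, B, hA, hQ, hB, _, _, _, M, φ, hφ, hM, rfl⟩ := h
  -- The extended system takes its values in `[a, b]`, so the retraction preserves the
  -- semiconjugacy.
  refine ⟨A, Q, B, hA, hQ, hB, M, fun x => projIcc a b hab (φ (Config.ofDiscontinuum x)),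
    continuous_projIcc.comp hφ.continuous, fun y => ?_, fun x => ?_⟩
  · obtain ⟨u, hu⟩ := hS y.2
    have hu' : Config.ofDiscontinuum u.toDiscontinuum = u := rfl
    exact ⟨u.toDiscontinuum, by simp only [hu', hu, projIcc_val]⟩
  · apply Subtype.ext
    simp only [Config.ofDiscontinuum_step, ← hM]
    rw [projIcc_of_mem hab (hg (projIcc a b hab _).2)]
    rfl

/-- If the renormalization of `g` is a factor of a finite automaton, then the second iterate of
`g` is presented on `[-p, p]`. -/
theorem presents_iterate_two {g G : ℝ → ℝ} (hg : IsSymmetricUnimodalSystem g) (h0 : 0 < g 0)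
    (hR : renormalization g 0 ≤ 1) (hG : EqOn G g (Icc (-1) 1))
    (hfactor : IsFactorOfFiniteAutomaton
      ((hg.mapsTo_renormalization h0 hR).restrict (renormalization g) (Icc (-1) 1) (Icc (-1) 1))) :
    Presents (fun x => G (G x)) (Icc (-renormalizationPoint g) (renormalizationPoint g)) := by
  obtain ⟨hp0, hp1, -, -⟩ := hg.isRenormalizationPoint h0
  obtain ⟨A, Q, B, hA, hQ, hB, M, φ, hφ, hs, hM⟩ := hfactor
  obtain ⟨x, -⟩ := hs ⟨0, by norm_num, by norm_num⟩
  -- The conjugacy is multiplication by `-p`: by evenness `g(g(-p y)) = g(g(p y))`, which is `-p`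
  -- times the renormalization at `y`.
  have hcont : Continuous fun x => -renormalizationPoint g * (φ x : ℝ) :=
    continuous_const.mul (continuous_subtype_val.comp hφ)
  refine ⟨A, Q, B, hA, hQ, hB, ⟨x (Int.ofNat 1)⟩, ⟨x (Int.ofNat 0)⟩, ⟨x (Int.negSucc 0)⟩, M,
    fun u => -renormalizationPoint g * (φ u.toDiscontinuum : ℝ),
    Config.isContinuous_comp_toDiscontinuum hcont, fun u => ?_, ?_⟩
  · have h : renormalization g (φ u.toDiscontinuum) = φ (M.next u).toDiscontinuum :=
      congrArg Subtype.val (FiniteAutomaton.next_toDiscontinuum_semiconj hM u)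
    simp only [← h]
    generalize φ u.toDiscontinuum = z
    obtain ⟨y, hyI⟩ := z
    have hpy : renormalizationPoint g * y ∈ Icc (-1 : ℝ) 1 := by
      constructor <;> nlinarith [hyI.1, hyI.2]
    have hpy' : -renormalizationPoint g * y ∈ Icc (-1 : ℝ) 1 := by
      constructor <;> nlinarith [hyI.1, hyI.2]
    have h1 : G (-renormalizationPoint g * y) = g (renormalizationPoint g * y) := by
      rw [hG hpy', neg_mul, hg.symmetric _ hpy]
    simp only [h1, hG (hg.mapsTo hpy), renormalization]
    field_simp
  · apply Subset.antisymm
    · rintro _ ⟨u, rfl⟩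
      have hy := (φ u.toDiscontinuum).2
      constructor <;> nlinarith [hy.1, hy.2]
    · intro y hy
      have hmem : -y / renormalizationPoint g ∈ Icc (-1 : ℝ) 1 := by
        constructor
        · rw [le_div_iff₀ hp0]; linarith [hy.2]
        · rw [div_le_one hp0]; linarith [hy.1]
      obtain ⟨x, hx⟩ := hs ⟨_, hmem⟩
      refine ⟨Config.ofDiscontinuum x, ?_⟩
      simp only [Config.toDiscontinuum_ofDiscontinuum, hx]
      field_simp

/-- Suppose that `G` increases on `[a, 0]`, exceeds the identity on `(e, 0]` for a fixed point `e`
there, and maps `-p` to `p`. Then a presentation of `G` on a set between `[-p, p]` and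
`[e, G 0]` extends to `[e, p]`. -/
theorem Presents.covers_Icc {G : ℝ → ℝ} (hG : Continuous G) {e p : ℝ} {S : Set ℝ}
    (hm : StrictMonoOn G (Icc e 0)) (hp : 0 < p) (hep : e < -p) (he : G e = e)
    (hgt : ∀ x, e < x → x ≤ 0 → x < G x) (hGp : G (-p) = p) (hS : Presents G S)
    (hpS : Icc (-p) p ⊆ S) (hSe : S ⊆ Icc e (G 0)) : Covers G (Icc e p) := by
  obtain ⟨A, Q, B, _, _, _, _, _, _, M, φ, hφ, hM, rfl⟩ := hS
  have he0 : e ≤ 0 := by linarith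
  obtain ⟨H, hH⟩ := exists_orderIso_eqOn_Icc he0 hG.continuousOn hm
  have hHe : H e = e := (hH ⟨le_rfl, he0⟩).trans he
  have hHe' : H.symm e = e := by rw [H.symm_apply_eq, hHe]
  have hH0 : H.symm (G 0) = 0 := by rw [H.symm_apply_eq, hH ⟨he0, le_rfl⟩]
  have hG0 : 0 < G 0 := hgt 0 (by linarith) le_rfl
  have hHp : H (-p) = p := (hH ⟨hep.le, by linarith⟩).trans hGp
  have hmaps : ∀ x ∈ Icc e (G 0), H.symm x ∈ Icc e 0 := fun x hx =>
    ⟨hHe' ▸ H.symm.monotone hx.1, hH0 ▸ H.symm.monotone hx.2⟩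
  -- Positive points also move down, since `H.symm` maps `[e, G 0]` into `[e, 0]`.
  have hlt : ∀ y, e < y → y ≤ G 0 → H.symm y < y := by
    intro y h1 h2
    rcases le_or_gt y 0 with h | h
    · rw [H.symm_apply_lt, hH ⟨h1.le, h⟩]
      exact hgt y h1 h
    · exact (hmaps y ⟨h1.le, h2⟩).2.trans_lt h
  have hlim : ∀ y ∈ Icc e (G 0), Filter.Tendsto (fun n => H.symm^[n] y) Filter.atTop (nhds e) :=
    fun y hy => tendsto_iterate_of_lt H.symm.continuous H.symm.monotone hy.1 hHe'
      fun z h1 h2 => hlt z h1 (h2.trans hy.2)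
  have hentry : ∀ u, φ u ∈ Icc e (G 0) := fun u => hSe (mem_range_self u)
  -- All values of `φ` are contracted to `e` by `H.symm`, so entry is allowed with any output tape.
  refine (covers_source (β := id) (h := H.symm) (P := Icc e (G 0)) hφ hM he H.symm.continuous
    (fun x hx => Icc_subset_Icc_right hG0.le (hmaps x hx))
    (fun x hx => (hH (hmaps x hx)).symm.trans (H.apply_symm_apply x))
    (fun u _ => hentry u)
    ((tendstoUniformlyOn_iterate_Icc H.symm.monotone (hlim e ⟨le_rfl, by linarith⟩)
      (hlim (G 0) ⟨by linarith, le_rfl⟩)).mono ?_)).mono ?_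
  · rintro x ⟨u, -, rfl⟩
    exact hentry u
  · intro x hx
    rcases hx.1.eq_or_lt with rfl | hex
    · exact Or.inl (Or.inr rfl)
    · have hlimp := hlim (-p) ⟨hep.le, by linarith⟩
      -- Since `H (-p) = p`, the interval `[-p, p]` is a fundamental domain of `H`.
      obtain ⟨n, hn⟩ := H.exists_iterate_mem_Icc hlimp hex (hx.2.trans hHp.ge)
      rw [hHp] at hn
      obtain ⟨u, hu⟩ := hpS hn
      refine Or.inr ⟨n, u, fun i => ⟨_, rfl⟩, ?_⟩
      rw [hu]
      exact (LeftInverse.iterate H.symm_apply_apply n) x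

theorem mainTheorem7 (g : ℝ → ℝ) (hg : IsSymmetricUnimodalSystem g) (h0 : 0 < g 0)
    (hfix : {x | x ∈ Icc (-1 : ℝ) 1 ∧ g x = x}.Finite)
    (hR : renormalization g 0 ≤ 1)
    (hfactor : IsFactorOfFiniteAutomaton
      ((hg.mapsTo_renormalization h0 hR).restrict (renormalization g) (Icc (-1) 1) (Icc (-1) 1))) :
    IsFactorOfFiniteAutomaton (hg.mapsTo.restrict g (Icc (-1) 1) (Icc (-1) 1)) := by
  have h11 : (-1 : ℝ) ≤ 1 := by norm_num
  apply Covers.isFactorOfFiniteAutomaton h11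
  set G : ℝ → ℝ := fun x => g (projIcc (-1) 1 h11 x) with hGdef
  have hGg : EqOn G g (Icc (-1) 1) := fun x hx => by simp only [G, projIcc_of_mem h11 hx]
  have hGc : Continuous G := hg.contDiffOn.continuousOn.comp_continuous
    (continuous_subtype_val.comp continuous_projIcc) fun x => (projIcc (-1) 1 h11 x).2
  have hGneg : ∀ x, G (-x) = G x := by
    intro x
    have hx : (projIcc (-1) 1 h11 (-x) : ℝ) = -(projIcc (-1) 1 h11 x : ℝ) := by
      simp only [coe_projIcc]
      rcases min_cases 1 (-x) with h1 | h1 <;> rcases min_cases 1 x with h2 | h2 <;>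
      rcases max_cases (-1) (min 1 (-x)) with h3 | h3 <;>
      rcases max_cases (-1) (min 1 x) with h4 | h4 <;> linarith
    simp only [G, hx, hg.symmetric _ (projIcc (-1) 1 h11 x).2]
  have hanti : StrictAntiOn G (Icc 0 1) := hg.strictAntiOn.congr fun x hx =>
    (hGg (Icc_subset_Icc_left (by norm_num) hx)).symm
  have hmono : StrictMonoOn G (Icc (-1) 0) := by
    intro x hx y hy hxy
    rw [← hGneg x, ← hGneg y]
    exact hanti ⟨by linarith [hy.2], by linarith [hy.1]⟩ ⟨by linarith [hx.2], by linarith [hx.1]⟩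
      (neg_lt_neg hxy)
  obtain ⟨hp0, hp1, hgp, -⟩ := hg.isRenormalizationPoint h0
  have hJ := presents_iterate_two hg h0 hR hGg hfactor
  set p := renormalizationPoint g
  have hGp : G (-p) = p := (hGg ⟨by linarith, by linarith⟩).trans hgp
  have hG0 : 0 < G 0 := by rwa [hGg ⟨by norm_num, by norm_num⟩]
  have hGm1 : G (-1) = -1 := (hGg ⟨le_rfl, h11⟩).trans hg.map_neg_one
  have hG1 : ∀ x, G x ≤ 1 := fun x => (hg.mapsTo (projIcc (-1) 1 h11 x).2).2
  have hGtop : ∀ x ∈ Icc (-1 : ℝ) 0, G x ≤ G 0 := fun x hx =>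
    hmono.monotoneOn hx ⟨by norm_num, le_rfl⟩ hx.2
  have hfin : {x | x ∈ Icc (-1 : ℝ) 0 ∧ G x = x}.Finite := hfix.subset fun x hx => by
    have hx1 : x ∈ Icc (-1 : ℝ) 1 := Icc_subset_Icc_right zero_le_one hx.1
    exact ⟨hx1, hGg hx1 ▸ hx.2⟩
  obtain ⟨e, ⟨heI, he⟩, hemax⟩ := hfin.exists_maximal ⟨-1, ⟨le_rfl, by norm_num⟩, hGm1⟩
  have hgt : ∀ x, e < x → x ≤ 0 → x < G x := by
    intro x hex hx0
    by_contra! hle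
    obtain ⟨z, hz, hz0⟩ := intermediate_value_Icc hx0 (hGc.sub continuous_id).continuousOn
      (show (0 : ℝ) ∈ Icc (G x - x) (G 0 - 0) from ⟨by linarith, by linarith⟩)
    have hez : e < z := hex.trans_le hz.1
    exact hez.not_ge (hemax ⟨⟨heI.1.trans hez.le, hz.2⟩, sub_eq_zero.1 hz0⟩ hez.le)
  -- Otherwise `p = G (-p) ≤ G e = e ≤ 0`.
  have hep : e < -p := by
    by_contra! hle
    have := hmono.monotoneOn ⟨by linarith, by linarith⟩ heI hle
    rw [hGp, he] at this
    linarith [heI.2]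
  have hGJ : ∀ x ∈ Icc (-p) p, G x ∈ Icc p (G 0) := by
    have key : ∀ x ∈ Icc (-p) 0, G x ∈ Icc p (G 0) := fun x hx => by
      have hx' : x ∈ Icc (-1 : ℝ) 0 := ⟨by linarith [hx.1], hx.2⟩
      exact ⟨hGp.symm.le.trans (hmono.monotoneOn ⟨by linarith, by linarith⟩ hx' hx.1),
        hGtop x hx'⟩
    intro x hx
    rcases le_total x 0 with h | h
    · exact key x ⟨hx.1, h⟩
    · rw [← hGneg x]
      exact key (-x) ⟨neg_le_neg hx.2, by linarith⟩
  have hpG0 : p ≤ G 0 := (hGJ 0 ⟨by linarith, hp0.le⟩).1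
  have hright : Covers G (Icc e p) := by
    refine Presents.covers_Icc hGc (hmono.mono (Icc_subset_Icc_left heI.1)) hp0 hep he hgt hGp
      (hJ.of_iterate_two hGc) subset_union_left ?_
    rintro x (hx | ⟨y, hy, rfl⟩)
    · exact ⟨hep.le.trans hx.1, hx.2.trans hpG0⟩
    · exact ⟨by linarith [(hGJ y hy).1], (hGJ y hy).2⟩
  have hleft : Covers G (Icc (-1) e) :=
    covers_Icc_of_finite_fixed hGc heI.1 (hmono.mono (Icc_subset_Icc_right heI.2)) hGm1 he
      (hfin.subset fun x hx => ⟨⟨hx.1.1, hx.1.2.trans heI.2⟩, hx.2⟩)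
  -- `[-1, p]` and its mirror image fill `[-1, 1]`, because `p > 0`.
  refine ((hleft.union hright).union_neg hGneg).mono fun x hx => ?_
  have key : ∀ y, -1 ≤ y → y ≤ p → y ∈ Icc (-1) e ∪ Icc e p := fun y h1 h2 =>
    (le_total y e).imp (fun h => ⟨h1, h⟩) fun h => ⟨h, h2⟩
  rcases le_total x p with h | h
  · exact Or.inl (key x hx.1 h)
  · exact Or.inr (key (-x) (by linarith [hx.2]) (by linarith))
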